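/- Let $n\ge 1$ be an integer and let $a=(a_k)_{k\ge0}$, $b=(b_k)_{k\ge0}$, $c=(c_k)_{k\ge0}$ be $(n+1)$-periodic sequences of complex numbers (that is, $a_{k+n+1}=a_k$ for all $k$, and likewise for $b$ and $c$). Let $T=T(a,b,c)$ be the bounded tridiagonal operator on $\ell^2(\mathbb N_0)$ given by $$(Tf)_0=b_0f_0+c_0f_1,\qquad (Tf)_k=a_kf_{k-1}+b_kf_k+c_kf_{k+1}\quad(k\ge1),$$ and let $W(T)=\{\langle Tf,f\rangle:\|f\|=1\}$ be its numerical range. For $0\le j<n$ put $$\alpha_j=\frac{c_j+\overline{a_{j+1}}}{2},\quad \gamma_j=\frac{c_j-\overline{a_{j+1}}}{2i},\qquad\text{and}\qquad \alpha_n=\frac{a_0+\overline{c_n}}{2},\quad \gamma_n=\frac{a_0-\overline{c_n}}{2i}.$$ For real $t,x,y$ let $\Lambda=(\lambda_{i,j})_{1\le i,j\le n+1}$ be the tridiagonal matrix with $$\lambda_{j,j}=t+\operatorname{Re}(b_{j-1})x+\operatorname{Im}(b_{j-1})y\quad(1\le j\le n+1),$$ $$\lambda_{j,j+1}=\alpha_{j-1}x+\gamma_{j-1}y,\qquad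 \lambda_{j+1,j}=\overline{\alpha_{j-1}}x+\overline{\gamma_{j-1}}y\quad(1\le j\le n),$$ and all other entries $0$. Let $G_n(t,x,y)=\det\Lambda$, and let $H_n(t,x,y)=\det(\lambda_{i,j})_{2\le i,j\le n}$, with $H_1=1$. Define $$P(t,x,y)=\bigl(G_n(t,x,y)-|\alpha_nx+\gamma_ny|^2H_n(t,x,y)\bigr)^2-4\prod_{j=0}^{n}|\alpha_jx+\gamma_jy|^2 .$$ Then $P$ is a homogeneous polynomial of degree $2(n+1)$ in $(t,x,y)$ with real coefficients, $P(t,0,0)=t^{2(n+1)}$ for all $t\in\mathbb R$, and for every $\theta\in\mathbb R$ the polynomial $P(t,-\cos\theta,-\sin\theta)$ in $t$ has a largest real root and $$\sup\{\operatorname{Re}(e^{-i\theta}z):z\in W(T)\}=\max\{t\in\mathbb R:P(t,-\cos\theta,-\sin\theta)=0\}.$$ -/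

import Mathlib

open scoped ComplexConjugate

namespace PeriodicTridiagonal

noncomputable section

/-- The Hilbert space `ℓ²(ℕ₀)` of complex sequences. -/
abbrev EllTwo : Type := lp (fun _ : ℕ => ℂ) 2

/-- The numerical range `W(A) = {⟨A x, x⟩ : ‖x‖ = 1}`. Mathlib's inner product is linear in its
second argument. -/
def numericalRange {E : Type*} [NormedAddCommGroup E] [InnerProductSpace ℂ E] (A : E →L[ℂ] E) :
    Set ℂ :=
  {z | ∃ x : E, ‖x‖ = 1 ∧ inner ℂ x (A x) = z}

/-- The action of the tridiagonal matrix with rows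
`(…, 0, a_k, b_k, c_k, 0, …)`, where `b_k` is on the diagonal, on a sequence. -/
def tridiagAction (a b c : ℕ → ℂ) (f : ℕ → ℂ) (k : ℕ) : ℂ :=
  (if k = 0 then 0 else a k * f (k - 1)) + b k * f k + c k * f (k + 1)

lemma exists_bound_of_periodic {n : ℕ} {a : ℕ → ℂ} (ha : Function.Periodic a (n + 1)) :
    ∃ C : ℝ, ∀ k, ‖a k‖ ≤ C := by
  refine ⟨∑ i ∈ Finset.range (n + 1), ‖a i‖, fun k => ?_⟩
  rw [← ha.map_mod_nat k]
  exact Finset.single_le_sum (f := fun i => ‖a i‖) (fun i _ => norm_nonneg _)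
    (Finset.mem_range.2 (Nat.mod_lt _ n.succ_pos))

lemma memℓp_two_iff (f : ℕ → ℂ) : Memℓp f 2 ↔ Summable fun k => ‖f k‖ ^ 2 := by
  rw [memℓp_gen_iff (by norm_num)]
  simp

lemma memℓp_mul {n : ℕ} {a : ℕ → ℂ} (ha : Function.Periodic a (n + 1)) {f : ℕ → ℂ}
    (hf : Memℓp f 2) : Memℓp (fun k => a k * f k) 2 := by
  obtain ⟨C, hC⟩ := exists_bound_of_periodic ha
  rw [memℓp_two_iff] at hf ⊢
  refine Summable.of_nonneg_of_le (fun k => by positivity) (fun k => ?_) (hf.mul_left (C ^ 2))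
  rw [norm_mul, mul_pow]
  have := hC k
  gcongr

lemma memℓp_tridiagAction {n : ℕ} {a b c : ℕ → ℂ} (ha : Function.Periodic a (n + 1))
    (hb : Function.Periodic b (n + 1)) (hc : Function.Periodic c (n + 1)) {f : ℕ → ℂ}
    (hf : Memℓp f 2) : Memℓp (tridiagAction a b c f) 2 := by
  have h1 : Memℓp (fun k : ℕ => if k = 0 then (0 : ℂ) else f (k - 1)) 2 := by
    rw [memℓp_two_iff] at hf ⊢
    rw [← summable_nat_add_iff 1]
    simpa using hf
  have h2 : Memℓp (fun k : ℕ => f (k + 1)) 2 := by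
    rw [memℓp_two_iff] at hf ⊢
    exact (summable_nat_add_iff 1).2 hf
  have h := ((memℓp_mul ha h1).add (memℓp_mul hb hf)).add (memℓp_mul hc h2)
  convert h using 1
  funext k
  simp [tridiagAction]

/-- The action of the tridiagonal matrix as a linear map of `ℓ²(ℕ₀)`. -/
def tridiagLinear {n : ℕ} {a b c : ℕ → ℂ} (ha : Function.Periodic a (n + 1))
    (hb : Function.Periodic b (n + 1)) (hc : Function.Periodic c (n + 1)) :
    EllTwo →ₗ[ℂ] EllTwo where
  toFun f := ⟨tridiagAction a b c f, memℓp_tridiagAction ha hb hc f.2⟩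
  map_add' f g := by
    ext k
    simp only [tridiagAction, lp.coeFn_add, Pi.add_apply]
    split_ifs <;> ring
  map_smul' r f := by
    ext k
    simp only [tridiagAction, lp.coeFn_smul, Pi.smul_apply, smul_eq_mul, RingHom.id_apply]
    split_ifs <;> ring

/-- The `(n+1)`-periodic tridiagonal operator `T(a, b, c)`, as a bounded operator on `ℓ²(ℕ₀)`. -/
def tridiagOp {n : ℕ} {a b c : ℕ → ℂ} (ha : Function.Periodic a (n + 1))
    (hb : Function.Periodic b (n + 1)) (hc : Function.Periodic c (n + 1)) :
    EllTwo →L[ℂ] EllTwo where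
  toLinearMap := tridiagLinear ha hb hc
  cont := by
    refine (tridiagLinear ha hb hc).continuous_of_seq_closed_graph fun u x y hu hTu => ?_
    have hev : ∀ k : ℕ, Continuous fun f : EllTwo => f k := fun k =>
      (lp.evalCLM ℂ (fun _ : ℕ => ℂ) 2 k).continuous
    ext k
    have h1 := ((hev k).tendsto y).comp hTu
    have h2 : Continuous fun f : EllTwo => tridiagLinear ha hb hc f k := by
      change Continuous fun f : EllTwo =>
        (if k = 0 then 0 else a k * f (k - 1)) + b k * f k + c k * f (k + 1)
      refine Continuous.add (Continuous.add ?_ ((hev k).const_mul (b k)))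
        ((hev (k + 1)).const_mul (c k))
      split_ifs
      · exact continuous_const
      · exact (hev (k - 1)).const_mul (a k)
    exact tendsto_nhds_unique h1 ((h2.tendsto x).comp hu)

lemma tridiagOp_apply {n : ℕ} {a b c : ℕ → ℂ} (ha : Function.Periodic a (n + 1))
    (hb : Function.Periodic b (n + 1)) (hc : Function.Periodic c (n + 1)) (f : EllTwo) (k : ℕ) :
    tridiagOp ha hb hc f k =
      (if k = 0 then 0 else a k * f (k - 1)) + b k * f k + c k * f (k + 1) := rfl

/-- The numbers `α_j`, `0 ≤ j ≤ n`. -/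
def alpha (n : ℕ) (a c : ℕ → ℂ) (j : ℕ) : ℂ :=
  if j < n then (c j + conj (a (j + 1))) / 2 else (a 0 + conj (c n)) / 2

/-- The numbers `γ_j`, `0 ≤ j ≤ n`. -/
def gamma (n : ℕ) (a c : ℕ → ℂ) (j : ℕ) : ℂ :=
  if j < n then (c j - conj (a (j + 1))) / (2 * Complex.I)
  else (a 0 - conj (c n)) / (2 * Complex.I)

/-- The entries of the tridiagonal matrices, with rows and columns numbered from `0`. -/
def entry (n : ℕ) (a b c : ℕ → ℂ) (t x y : ℝ) (i j : ℕ) : ℂ :=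
  if j = i then ((t + (b i).re * x + (b i).im * y : ℝ) : ℂ)
  else if j = i + 1 then alpha n a c i * x + gamma n a c i * y
  else if i = j + 1 then conj (alpha n a c j) * x + conj (gamma n a c j) * y
  else 0

/-- `G_n(t, x, y)`: the determinant of the full `(n+1) × (n+1)` tridiagonal matrix. -/
def G (n : ℕ) (a b c : ℕ → ℂ) (t x y : ℝ) : ℂ :=
  (Matrix.of fun i j : Fin (n + 1) => entry n a b c t x y i j).det

/-- `H_n(t, x, y)`: the determinant of the `(n-1) × (n-1)` tridiagonal matrix obtained by removing
the first and last rows and columns; it is `1` for `n = 1`. -/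
def H (n : ℕ) (a b c : ℕ → ℂ) (t x y : ℝ) : ℂ :=
  (Matrix.of fun i j : Fin (n - 1) => entry n a b c t x y (i + 1) (j + 1)).det

/-- `P(t, x, y)`, as the complex number that the defining formula gives. -/
def P (n : ℕ) (a b c : ℕ → ℂ) (t x y : ℝ) : ℂ :=
  (G n a b c t x y
      - ((‖alpha n a c n * x + gamma n a c n * y‖ ^ 2 : ℝ) : ℂ) * H n a b c t x y) ^ 2
    - 4 * ∏ j ∈ Finset.range (n + 1), ((‖alpha n a c j * x + gamma n a c j * y‖ ^ 2 : ℝ) : ℂ)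

end

end PeriodicTridiagonal

/-!
For `ω = exp (-iθ)`, `Re (ω ⟨T f, f⟩)` is the quadratic form of a self-adjoint periodic Jacobi
operator with complex off-diagonal entries, and conjugation with a diagonal unitary replaces these
by their absolute values `v`. Folding `|f|` along the residue classes modulo `n + 1`, with
Cauchy–Schwarz, bounds the form by that of a real cyclic Jacobi matrix `C` of size `n + 1`, and
truncations of periodic sequences show that this bound is sharp. So the supremum is the largest
eigenvalue of `C`. The characteristic polynomial of `C` is `χ = Δ - 2 ∏ v`, where `Δ` is the trace
of the monodromy matrix, whence `P = Δ² - 4 ∏ v² = χ (χ + 4 ∏ v)`, which has no zero to the right of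
the largest root of `χ`.
-/

namespace PeriodicTridiagonal

open Finset Matrix

section LinearAlgebra

variable {R : Type*} [CommRing R]

/-- The tridiagonal matrix of size `m` with diagonal `d`, superdiagonal `p` and subdiagonal `q`. -/
def tridiagonal (d p q : ℕ → R) (m : ℕ) : Matrix (Fin m) (Fin m) R :=
  Matrix.of fun i j =>
    if (j : ℕ) = i then d i else if (j : ℕ) = i + 1 then p i else if (i : ℕ) = j + 1 then q j else 0

/-- The continuant: the value of the tridiagonal determinant of size `m` with diagonal `d` in which
`s k` is the product of the two off-diagonal entries between the indices `k` and `k + 1`. -/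
def continuant (d s : ℕ → R) : ℕ → R
  | 0 => 1
  | 1 => d 0
  | m + 2 => d (m + 1) * continuant d s (m + 1) - s m * continuant d s m

lemma transpose_tridiagonal (d p q : ℕ → R) (m : ℕ) :
    (tridiagonal d p q m)ᵀ = tridiagonal d q p m := by
  ext i j
  simp only [tridiagonal, transpose_apply, of_apply]
  grind

lemma det_tridiagonal_succ_succ (d p q : ℕ → R) (m : ℕ) :
    (tridiagonal d p q (m + 2)).det =
      d (m + 1) * (tridiagonal d p q (m + 1)).det - p m * q m * (tridiagonal d p q m).det := by
  set A := tridiagonal d p q (m + 2) with hA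
  have minor : (A.submatrix Fin.castSucc (Fin.last m).castSucc.succAbove).det =
      p m * (tridiagonal d p q m).det := by
    rw [det_succ_column _ (Fin.last m), Fin.sum_univ_castSucc]
    have h0 (i : Fin m) : A i.castSucc.castSucc (Fin.last (m + 1)) = 0 := by
      simp only [hA, tridiagonal, of_apply]
      grind
    have hp : A (Fin.last m).castSucc (Fin.last (m + 1)) = p m := by simp [hA, tridiagonal]
    have hsub : A.submatrix (fun i : Fin m => i.castSucc.castSucc)
        (fun j => (Fin.last m).castSucc.succAbove j.castSucc) = tridiagonal d p q m := by
      ext i j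
      simp [hA, tridiagonal, Fin.succAbove_of_castSucc_lt]
    simp only [submatrix_apply, submatrix_submatrix, Function.comp_def, Fin.succAbove_castSucc_self,
      Fin.succ_last, Fin.succAbove_last, h0, hp, hsub]
    simp
  rw [det_succ_row _ (Fin.last (m + 1)), Fin.sum_univ_castSucc, Fin.sum_univ_castSucc]
  have h0 (j : Fin m) : A (Fin.last (m + 1)) j.castSucc.castSucc = 0 := by
    simp only [hA, tridiagonal, of_apply]
    grind
  have hq : A (Fin.last (m + 1)) (Fin.last m).castSucc = q m := by
    simp only [hA, tridiagonal, of_apply]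
    grind
  have hd : A (Fin.last (m + 1)) (Fin.last (m + 1)) = d (m + 1) := by simp [hA, tridiagonal]
  have lead : A.submatrix Fin.castSucc Fin.castSucc = tridiagonal d p q (m + 1) := rfl
  simp only [h0, hq, hd, Fin.succAbove_last, minor, lead, Fin.val_last, Fin.val_castSucc]
  simp only [mul_zero, zero_mul, sum_const_zero, zero_add,
    Odd.neg_one_pow (show Odd (m + 1 + m) from ⟨m, by ring⟩),
    Even.neg_one_pow (show Even (m + 1 + (m + 1)) from ⟨m + 1, rfl⟩)]
  ring

lemma det_tridiagonal (d p q : ℕ → R) (m : ℕ) :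
    (tridiagonal d p q m).det = continuant d (fun k => p k * q k) m := by
  induction m using Nat.twoStepInduction with
  | zero => exact det_isEmpty
  | one => simp [tridiagonal, continuant]
  | more m ih₀ ih₁ => rw [det_tridiagonal_succ_succ, ih₀, ih₁, continuant]

lemma det_submatrix_succ_castSucc_tridiagonal (d p q : ℕ → R) (m : ℕ) :
    ((tridiagonal d p q (m + 1)).submatrix Fin.succ Fin.castSucc).det = ∏ j ∈ range m, q j := by
  rw [det_of_isUpperTriangular, ← Fin.prod_univ_eq_prod_range]
  · refine prod_congr rfl fun i _ => ?_
    simp only [tridiagonal, submatrix_apply, of_apply, Fin.val_succ, Fin.val_castSucc]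
    grind
  · intro i j (hij : (j : ℕ) < i)
    simp only [tridiagonal, submatrix_apply, of_apply, Fin.val_succ, Fin.val_castSucc]
    grind

lemma det_submatrix_castSucc_succ_tridiagonal (d p q : ℕ → R) (m : ℕ) :
    ((tridiagonal d p q (m + 1)).submatrix Fin.castSucc Fin.succ).det = ∏ j ∈ range m, p j := by
  rw [← det_submatrix_succ_castSucc_tridiagonal d q p, ← transpose_tridiagonal d p q,
    ← det_transpose, transpose_submatrix]

lemma det_add_single {m : Type*} [Fintype m] [DecidableEq m] (A : Matrix m m R) (i j : m) (x : R) :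
    (A + single i j x).det = A.det + x * A.adjugate j i := by
  have : A + single i j x = A.updateRow i (A i + x • Pi.single j 1) := by
    ext k l
    obtain rfl | h := eq_or_ne k i
    · simp [single_apply, Pi.single_apply, eq_comm]
    · simp [h, h.symm]
  rw [this, det_updateRow_add, det_updateRow_smul, updateRow_eq_self, adjugate_apply]

lemma det_add_single_corners {m : ℕ} (A : Matrix (Fin (m + 2)) (Fin (m + 2)) R) (x y : R) :
    (A + single 0 (Fin.last _) x + single (Fin.last _) 0 y).det =
      A.det - x * y * (A.submatrix (fun i : Fin m => i.succ.castSucc)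
          fun i : Fin m => i.succ.castSucc).det
        + (-1) ^ (m + 1) * (x * (A.submatrix Fin.succ Fin.castSucc).det
          + y * (A.submatrix Fin.castSucc Fin.succ).det) := by
  have hsub : (A + single 0 (Fin.last (m + 1)) x).submatrix Fin.castSucc Fin.succ =
      A.submatrix Fin.castSucc Fin.succ + single 0 (Fin.last m) x := by
    ext i j
    simp [single_apply, ← Fin.succ_last, Fin.ext_iff]
  rw [det_add_single, det_add_single]
  simp only [adjugate_fin_succ_eq_det_submatrix, Fin.succAbove_last, Fin.succAbove_zero]
  rw [hsub, det_add_single, adjugate_fin_succ_eq_det_submatrix, submatrix_submatrix]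
  simp only [Fin.succAbove_last, Fin.succAbove_zero, Function.comp_def, Fin.val_zero, Fin.val_last,
    add_zero, zero_add, Fin.succ_castSucc]
  have hsign : (-1 : R) ^ (m + 1) * (-1) ^ m = -1 := by
    rw [← pow_add]; exact Odd.neg_one_pow ⟨m, by ring⟩
  linear_combination (x * y *
    (A.submatrix (fun i : Fin m => i.succ.castSucc) fun i : Fin m => i.succ.castSucc).det) * hsign

/-- The trace of the monodromy matrix of the three-term recurrence with `(n + 1)`-periodic diagonal
`d` and `(n + 1)`-periodic off-diagonal products `s`, for `1 ≤ n`. -/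
def monodromyTrace (n : ℕ) (d s : ℕ → R) : R :=
  continuant d s (n + 1) - s n * continuant (fun k => d (k + 1)) (fun k => s (k + 1)) (n - 1)

/-- The discriminant of the characteristic polynomial of the monodromy matrix, whose determinant is
`∏ s`. -/
def monodromyDiscrim (n : ℕ) (d s : ℕ → R) : R :=
  monodromyTrace n d s ^ 2 - 4 * ∏ j ∈ range (n + 1), s j

/-- The cyclic shift of `Fin (n + 1)` with weights `v`, as a matrix. -/
def weightedShift (v : ℕ → R) (n : ℕ) : Matrix (Fin (n + 1)) (Fin (n + 1)) R :=
  Matrix.of fun i j => if j = i + 1 then v i else 0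

/-- The Jacobi matrix with diagonal `d` and couplings `v` closed up to a cycle of length `n + 1`:
the entry `v n` couples the last index with the first one. -/
def cyclicJacobi (d v : ℕ → R) (n : ℕ) : Matrix (Fin (n + 1)) (Fin (n + 1)) R :=
  diagonal (fun i : Fin (n + 1) => d i) + weightedShift v n + (weightedShift v n)ᵀ

lemma cyclicJacobi_succ (d v : ℕ → R) (m : ℕ) :
    cyclicJacobi d v (m + 1) = tridiagonal d v v (m + 2) + single 0 (Fin.last _) (v (m + 1))
      + single (Fin.last _) 0 (v (m + 1)) := by
  ext i j
  simp only [cyclicJacobi, weightedShift, tridiagonal, Matrix.add_apply, transpose_apply, of_apply,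
    diagonal_apply, single_apply, Fin.ext_iff, Fin.val_add_one, Fin.val_zero, Fin.val_last]
  grind

lemma det_cyclicJacobi_succ (d v : ℕ → R) (m : ℕ) :
    (cyclicJacobi d v (m + 1)).det = monodromyTrace (m + 1) d (fun k => v k ^ 2)
      + 2 * (-1) ^ (m + 1) * ∏ j ∈ range (m + 2), v j := by
  have inner : (tridiagonal d v v (m + 2)).submatrix (fun i : Fin m => i.succ.castSucc)
      (fun i : Fin m => i.succ.castSucc) =
      tridiagonal (fun k => d (k + 1)) (fun k => v (k + 1)) (fun k => v (k + 1)) m := by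
    ext i j
    simp [tridiagonal]
  rw [cyclicJacobi_succ, det_add_single_corners, inner, det_submatrix_succ_castSucc_tridiagonal,
    det_submatrix_castSucc_succ_tridiagonal, det_tridiagonal, det_tridiagonal, monodromyTrace,
    prod_range_succ _ (m + 1)]
  simp only [← pow_two, Nat.add_sub_cancel]
  ring

lemma eval_charpoly_cyclicJacobi (d v : ℕ → R) (n : ℕ) (t : R) :
    (cyclicJacobi d v n).charpoly.eval t =
      (cyclicJacobi (fun k => t - d k) (fun k => -v k) n).det := by
  rw [eval_charpoly]
  congr 1
  ext i j
  simp only [cyclicJacobi, weightedShift, Matrix.sub_apply, Matrix.add_apply, transpose_apply,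
    of_apply, scalar_apply, diagonal_apply]
  split_ifs <;> ring

theorem monodromyDiscrim_eq_charpoly_mul {n : ℕ} (hn : 1 ≤ n) (d v : ℕ → R) (t : R) :
    monodromyDiscrim n (fun k => t - d k) (fun k => v k ^ 2) =
      (cyclicJacobi d v n).charpoly.eval t *
        ((cyclicJacobi d v n).charpoly.eval t + 4 * ∏ j ∈ range (n + 1), v j) := by
  obtain ⟨m, rfl⟩ := Nat.exists_eq_add_of_le' hn
  have hχ : (cyclicJacobi d v (m + 1)).charpoly.eval t =
      monodromyTrace (m + 1) (fun k => t - d k) (fun k => v k ^ 2)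
        - 2 * ∏ j ∈ range (m + 2), v j := by
    have hsign : (-1 : R) ^ (m + 1) * (-1) ^ (m + 2) = -1 := by
      rw [← pow_add]; exact Odd.neg_one_pow ⟨m + 1, by ring⟩
    rw [eval_charpoly_cyclicJacobi, det_cyclicJacobi_succ, prod_neg, card_range]
    simp only [neg_sq]
    linear_combination (2 * ∏ j ∈ range (m + 2), v j) * hsign
  rw [hχ, monodromyDiscrim, prod_pow]
  ring

lemma map_continuant {S : Type*} [CommRing S] (φ : R →+* S) (d s : ℕ → R) (m : ℕ) :
    φ (continuant d s m) = continuant (fun k => φ (d k)) (fun k => φ (s k)) m := by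
  induction m using Nat.twoStepInduction with
  | zero => simp [continuant]
  | one => rfl
  | more m ih₀ ih₁ => simp only [continuant, map_sub, map_mul, ih₀, ih₁]

lemma map_monodromyDiscrim {S : Type*} [CommRing S] (φ : R →+* S) (n : ℕ) (d s : ℕ → R) :
    φ (monodromyDiscrim n d s) = monodromyDiscrim n (fun k => φ (d k)) (fun k => φ (s k)) := by
  simp only [monodromyDiscrim, monodromyTrace, map_sub, map_pow, map_mul, map_prod, map_continuant,
    map_ofNat]

lemma continuant_congr {d s s' : ℕ → R} {m : ℕ} (h : ∀ k, k + 1 < m → s k = s' k) :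
    continuant d s m = continuant d s' m := by
  induction m using Nat.twoStepInduction with
  | zero => rfl
  | one => rfl
  | more m ih₀ ih₁ =>
    rw [continuant, continuant, h m (by omega), ih₀ fun k hk => h k (by omega),
      ih₁ fun k hk => h k (by omega)]

lemma monodromyDiscrim_congr {n : ℕ} {d s s' : ℕ → R} (h : ∀ k ≤ n, s k = s' k) :
    monodromyDiscrim n d s = monodromyDiscrim n d s' := by
  have hprod : ∏ j ∈ range (n + 1), s j = ∏ j ∈ range (n + 1), s' j :=
    prod_congr rfl fun j hj => h j (mem_range_succ_iff.1 hj)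
  rw [monodromyDiscrim, monodromyDiscrim, monodromyTrace, monodromyTrace, h n le_rfl, hprod,
    continuant_congr fun k hk => h k (by omega), continuant_congr fun k hk => h (k + 1) (by omega)]

lemma monodromyDiscrim_const_zero (n : ℕ) (t : R) :
    monodromyDiscrim n (fun _ => t) (fun _ => 0) = t ^ (2 * (n + 1)) := by
  have hc (m : ℕ) : continuant (fun _ => t) (fun _ => 0) m = t ^ m := by
    induction m using Nat.twoStepInduction with
    | zero => simp [continuant]
    | one => simp [continuant]
    | more m _ ih => rw [continuant, ih]; ring
  simp only [monodromyDiscrim, monodromyTrace, hc, prod_const, card_range,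
    zero_pow n.succ_ne_zero]
  ring

end LinearAlgebra

section Homogeneous

open MvPolynomial

variable {σ R : Type*} [CommRing R] {d s : ℕ → MvPolynomial σ R}

lemma isHomogeneous_continuant (hd : ∀ k, (d k).IsHomogeneous 1) (hs : ∀ k, (s k).IsHomogeneous 2)
    (m : ℕ) : (continuant d s m).IsHomogeneous m := by
  induction m using Nat.twoStepInduction with
  | zero => exact isHomogeneous_one σ R
  | one => exact hd 0
  | more m ih₀ ih₁ =>
    have h₁ := (hd (m + 1)).mul ih₁
    have h₀ := (hs m).mul ih₀
    rw [show 1 + (m + 1) = m + 2 by omega] at h₁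
    rw [add_comm] at h₀
    exact h₁.sub h₀

lemma isHomogeneous_monodromyDiscrim {n : ℕ} (hn : 1 ≤ n) (hd : ∀ k, (d k).IsHomogeneous 1)
    (hs : ∀ k, (s k).IsHomogeneous 2) :
    (monodromyDiscrim n d s).IsHomogeneous (2 * (n + 1)) := by
  have hcorner := (hs n).mul (isHomogeneous_continuant (fun k => hd (k + 1))
    (fun k => hs (k + 1)) (n - 1))
  rw [show 2 + (n - 1) = n + 1 by omega] at hcorner
  have htrace := ((isHomogeneous_continuant hd hs (n + 1)).sub hcorner).pow 2
  have hprod := (isHomogeneous_C σ (4 : R)).mul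
    (IsHomogeneous.prod (range (n + 1)) s _ fun j _ => hs j)
  simp only [sum_const, card_range, smul_eq_mul, zero_add, mul_comm (n + 1) 2, map_ofNat]
    at htrace hprod
  exact htrace.sub hprod

end Homogeneous

section Spectrum

variable {ι : Type*} [Fintype ι] [DecidableEq ι] {A : Matrix ι ι ℝ}

lemma forall_dotProduct_mulVec_le_iff (hA : A.IsHermitian) (s : ℝ) :
    (∀ g, g ⬝ᵥ A *ᵥ g ≤ s * (g ⬝ᵥ g)) ↔ ∀ i, hA.eigenvalues i ≤ s := by
  have hsub : (algebraMap ℝ _ s - A).IsHermitian := by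
    rw [Algebra.algebraMap_eq_smul_one]
    exact (isHermitian_one.smul (IsSelfAdjoint.all s)).sub hA
  calc _ ↔ (algebraMap ℝ _ s - A).PosSemidef := by
        simp only [posSemidef_iff_dotProduct_mulVec, hsub, true_and]
        simp [Algebra.algebraMap_eq_smul_one, sub_mulVec, smul_mulVec]
    _ ↔ spectrum ℝ (algebraMap ℝ _ s - A) ⊆ Set.Ici 0 := by
      rw [hsub.posSemidef_iff_eigenvalues_nonneg, hsub.spectrum_real_eq_range_eigenvalues,
        Set.range_subset_iff]
      rfl
    _ ↔ _ := by
      rw [← spectrum.singleton_sub_eq, hA.spectrum_real_eq_range_eigenvalues]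
      simp [Set.subset_def]

lemma isGreatest_setOf_eval_charpoly_mul [Nonempty ι] (hA : A.IsHermitian) {c : ℝ} (hc : 0 ≤ c) :
    IsGreatest {t | A.charpoly.eval t * (A.charpoly.eval t + c) = 0} (⨆ i, hA.eigenvalues i) := by
  have hχ (t : ℝ) : A.charpoly.eval t = ∏ i, (t - hA.eigenvalues i) := by
    simp [hA.charpoly_eq, Polynomial.eval_prod]
  refine ⟨?_, fun t ht => ?_⟩
  · obtain ⟨i, hi⟩ := exists_eq_ciSup_of_finite (f := hA.eigenvalues)
    have : A.charpoly.eval (⨆ i, hA.eigenvalues i) = 0 := by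
      rw [hχ]; exact prod_eq_zero (mem_univ i) (sub_eq_zero.2 hi.symm)
    simp [this]
  · by_contra! hlt
    have hpos : 0 < A.charpoly.eval t := by
      rw [hχ]
      exact prod_pos fun i _ => sub_pos.2 <| (le_ciSup (Set.finite_range _).bddAbove i).trans_lt hlt
    exact (mul_pos hpos (by positivity)).ne' ht

end Spectrum

lemma isHermitian_cyclicJacobi (d v : ℕ → ℝ) (n : ℕ) : (cyclicJacobi d v n).IsHermitian := by
  simp [IsHermitian, cyclicJacobi, conjTranspose_eq_transpose_of_trivial, add_assoc,
    add_comm (weightedShift v n)]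

lemma dotProduct_cyclicJacobi_mulVec (d v : ℕ → ℝ) (n : ℕ) (g : Fin (n + 1) → ℝ) :
    g ⬝ᵥ cyclicJacobi d v n *ᵥ g =
      ∑ i : Fin (n + 1), (d i * g i ^ 2 + 2 * (v i * (g i * g (i + 1)))) := by
  have hdiag : g ⬝ᵥ (diagonal (fun i : Fin (n + 1) => d i) *ᵥ g) =
      ∑ i : Fin (n + 1), d i * g i ^ 2 := by
    simp only [dotProduct, mulVec_diagonal]
    exact sum_congr rfl fun i _ => by ring
  have hshift : g ⬝ᵥ (weightedShift v n *ᵥ g) = ∑ i : Fin (n + 1), v i * (g i * g (i + 1)) := by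
    simp only [dotProduct, mulVec, weightedShift, of_apply, ite_mul, zero_mul, sum_ite_eq',
      mem_univ, if_true]
    exact sum_congr rfl fun i _ => by ring
  rw [cyclicJacobi, add_mulVec, add_mulVec, dotProduct_add, dotProduct_add, hdiag,
    mulVec_transpose, dotProduct_comm g (g ᵥ* _), ← dotProduct_mulVec, hshift, sum_add_distrib,
    ← mul_sum]
  ring

section PeriodicForm

variable {n : ℕ} {β v : ℕ → ℝ}

/-- The `k`-th term of the quadratic form of the Jacobi operator on `ℕ` with diagonal `β` and
couplings `v`, at the real sequence `h`. -/
def jacobiTerm (β v h : ℕ → ℝ) (k : ℕ) : ℝ :=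
  β k * h k ^ 2 + 2 * (v k * (h k * h (k + 1)))

lemma summable_mul_of_sq {x y : ℕ → ℝ} (hx : Summable fun k => x k ^ 2)
    (hy : Summable fun k => y k ^ 2) : Summable fun k => x k * y k := by
  refine Summable.of_norm_bounded (hx.add hy) fun k => ?_
  rw [Real.norm_eq_abs, abs_le]
  constructor <;> nlinarith [sq_nonneg (x k + y k), sq_nonneg (x k - y k)]

lemma tsum_mul_le_sqrt_mul_sqrt {x y : ℕ → ℝ} (hx : Summable fun k => x k ^ 2)
    (hy : Summable fun k => y k ^ 2) :
    ∑' k, x k * y k ≤ √(∑' k, x k ^ 2) * √(∑' k, y k ^ 2) := by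
  calc ∑' k, x k * y k ≤ ∑' k, |x k| * |y k| :=
        (summable_mul_of_sq hx hy).tsum_le_tsum (fun k => (le_abs_self _).trans_eq (abs_mul _ _))
          (summable_mul_of_sq (by simpa using hx) (by simpa using hy))
    _ ≤ _ := by
      simpa [Real.sqrt_eq_rpow] using
        Real.inner_le_Lp_mul_Lq_tsum_of_nonneg Real.HolderConjugate.two_two
          (fun k => abs_nonneg (x k)) (fun k => abs_nonneg (y k)) (by simpa using hx)
          (by simpa using hy)

lemma summable_mul_of_periodic {w x : ℕ → ℝ} (hw : Function.Periodic w (n + 1))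
    (hx : Summable x) : Summable fun k => w k * x k := by
  obtain ⟨C, hC⟩ := exists_bound_of_periodic (n := n) (a := fun k => (w k : ℂ))
    fun k => by simp only [hw k]
  refine .of_norm_bounded (hx.norm.mul_left C) fun k => ?_
  rw [norm_mul, ← Complex.norm_real (w k)]
  exact mul_le_mul_of_nonneg_right (hC k) (norm_nonneg _)

lemma summable_jacobiTerm (hβ : Function.Periodic β (n + 1)) (hv : Function.Periodic v (n + 1))
    {h : ℕ → ℝ} (hh : Summable fun k => h k ^ 2) : Summable (jacobiTerm β v h) :=
  (summable_mul_of_periodic hβ hh).add <| .mul_left 2 <|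
    summable_mul_of_periodic hv <| summable_mul_of_sq hh ((summable_nat_add_iff 1).2 hh)

lemma map_add_mul_of_periodic {w : ℕ → ℝ} {N : ℕ} (hw : Function.Periodic w N) (j m : ℕ) :
    w (j + N * m) = w j := by
  rw [← hw.map_mod_nat, Nat.add_mul_mod_self_left, hw.map_mod_nat]

/-- The `ℓ²`-norm of the restriction of `h` to the residue class of `j` modulo `N`. -/
noncomputable def foldNorm (N : ℕ) (h : ℕ → ℝ) (j : ℕ) : ℝ :=
  √(∑' m, h (j + N * m) ^ 2)

lemma sq_foldNorm (N : ℕ) (h : ℕ → ℝ) (j : ℕ) :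
    foldNorm N h j ^ 2 = ∑' m, h (j + N * m) ^ 2 :=
  Real.sq_sqrt (tsum_nonneg fun _ => sq_nonneg _)

lemma summable_sq_residueClass {h : ℕ → ℝ} (hh : Summable fun k => h k ^ 2) (j : ℕ) :
    Summable fun m => h (j + (n + 1) * m) ^ 2 :=
  hh.comp_injective (i := fun m => j + (n + 1) * m) fun _ _ => by simp

lemma foldNorm_add_period_le {h : ℕ → ℝ} (hh : Summable fun k => h k ^ 2) (j : ℕ) :
    foldNorm (n + 1) h (j + (n + 1)) ≤ foldNorm (n + 1) h j := by
  refine Real.sqrt_le_sqrt ?_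
  rw [(summable_sq_residueClass hh j).tsum_eq_zero_add]
  simp only [mul_add, mul_one, add_assoc, add_comm ((n + 1) * _)]
  exact le_add_of_nonneg_left (sq_nonneg _)

lemma tsum_mul_succ_le_foldNorm_mul {h : ℕ → ℝ} (hh : Summable fun k => h k ^ 2)
    (j : Fin (n + 1)) :
    ∑' m, h (j + (n + 1) * m) * h (j + (n + 1) * m + 1) ≤
      foldNorm (n + 1) h j * foldNorm (n + 1) h (j + 1 : Fin (n + 1)) := by
  have hsucc : foldNorm (n + 1) h (j + 1 : ℕ) ≤ foldNorm (n + 1) h (j + 1 : Fin (n + 1)) := by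
    rw [Fin.val_add_one]
    split_ifs with hj
    · simpa [hj] using foldNorm_add_period_le (n := n) hh 0
    · exact le_rfl
  simp only [add_right_comm _ _ 1]
  exact (tsum_mul_le_sqrt_mul_sqrt (summable_sq_residueClass hh _)
    (summable_sq_residueClass hh _)).trans
      (mul_le_mul_of_nonneg_left hsucc (Real.sqrt_nonneg _))

lemma tsum_eq_sum_tsum_residueClass {f : ℕ → ℝ} (hf : Summable f) :
    ∑' k, f k = ∑ j : Fin (n + 1), ∑' m, f (j + (n + 1) * m) :=
  Nat.sumByResidueClasses hf (n + 1)

lemma tsum_sq_eq_foldNorm_dotProduct {h : ℕ → ℝ} (hh : Summable fun k => h k ^ 2) :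
    ∑' k, h k ^ 2 =
      (fun j : Fin (n + 1) => foldNorm (n + 1) h j) ⬝ᵥ fun j => foldNorm (n + 1) h j := by
  simp only [tsum_eq_sum_tsum_residueClass (n := n) hh, dotProduct, ← pow_two, sq_foldNorm]

lemma tsum_jacobiTerm_le_foldNorm (hβ : Function.Periodic β (n + 1))
    (hv : Function.Periodic v (n + 1)) (hv0 : ∀ k, 0 ≤ v k) {h : ℕ → ℝ}
    (hh : Summable fun k => h k ^ 2) :
    ∑' k, jacobiTerm β v h k ≤ (fun j : Fin (n + 1) => foldNorm (n + 1) h j) ⬝ᵥ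
      cyclicJacobi β v n *ᵥ fun j => foldNorm (n + 1) h j := by
  rw [tsum_eq_sum_tsum_residueClass (n := n) (summable_jacobiTerm hβ hv hh),
    dotProduct_cyclicJacobi_mulVec]
  refine sum_le_sum fun j _ => ?_
  have hsq := summable_sq_residueClass (n := n) hh j
  have hmul : Summable fun m => h (j + (n + 1) * m) * h (j + (n + 1) * m + 1) := by
    simp only [add_right_comm _ _ 1]
    exact summable_mul_of_sq hsq (summable_sq_residueClass hh _)
  simp only [jacobiTerm, map_add_mul_of_periodic hβ, map_add_mul_of_periodic hv]
  rw [(hsq.mul_left _).tsum_add ((hmul.mul_left _).mul_left _), tsum_mul_left, tsum_mul_left,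
    tsum_mul_left, sq_foldNorm]
  gcongr
  · exact hv0 j
  · exact tsum_mul_succ_le_foldNorm_mul hh j

lemma hasSum_sq_indicator_Iio (h : ℕ → ℝ) (N : ℕ) :
    HasSum (fun k => (Set.Iio N).indicator h k ^ 2) (∑ k ∈ range N, h k ^ 2) := by
  convert hasSum_sum_of_ne_finset_zero (L := .unconditional ℕ) (s := range N)
    (f := fun k => (Set.Iio N).indicator h k ^ 2) (fun k hk => ?_) using 1
  · exact sum_congr rfl fun k hk => by simp [mem_range.1 hk]
  · simp [mem_range.not.1 hk]

lemma hasSum_jacobiTerm_indicator_Iio (β v h : ℕ → ℝ) (N : ℕ) :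
    HasSum (jacobiTerm β v ((Set.Iio (N + 1)).indicator h))
      (∑ k ∈ range (N + 1), jacobiTerm β v h k - 2 * (v N * (h N * h (N + 1)))) := by
  convert hasSum_sum_of_ne_finset_zero (L := .unconditional ℕ) (s := range (N + 1))
    (f := jacobiTerm β v ((Set.Iio (N + 1)).indicator h)) ?_ using 1
  · rw [sum_range_succ, sum_range_succ, add_sub_assoc]
    congr 1
    · refine sum_congr rfl fun k hk => ?_
      have := mem_range.1 hk
      simp [jacobiTerm, this, this.trans N.lt_succ_self]
    · simp [jacobiTerm]
  · simp +contextual [jacobiTerm]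

lemma sum_range_mul_of_periodic {F : ℕ → ℝ} {N : ℕ} (hF : Function.Periodic F N) (M : ℕ) :
    ∑ k ∈ range (N * M), F k = M * ∑ k ∈ range N, F k := by
  induction M with
  | zero => simp
  | succ M ih =>
    rw [Nat.mul_succ, sum_range_add, ih]
    simp only [add_comm (N * M), map_add_mul_of_periodic hF]
    push_cast
    ring

/-- The extension of a vector indexed by `Fin (n + 1)` to an `(n + 1)`-periodic sequence. -/
def periodicExtension (g : Fin (n + 1) → ℝ) (k : ℕ) : ℝ :=
  g (Fin.ofNat (n + 1) k)

lemma periodic_periodicExtension (g : Fin (n + 1) → ℝ) :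
    Function.Periodic (periodicExtension g) (n + 1) := fun k =>
  congrArg g (Fin.ext (by simp))

lemma periodicExtension_val (g : Fin (n + 1) → ℝ) (i : Fin (n + 1)) :
    periodicExtension g i = g i := by
  simp [periodicExtension]

lemma periodicExtension_val_succ (g : Fin (n + 1) → ℝ) (i : Fin (n + 1)) :
    periodicExtension g (i + 1) = g (i + 1) :=
  congrArg g (Fin.ext (by simp [Fin.val_add]))

lemma sum_range_jacobiTerm_periodicExtension (β v : ℕ → ℝ) (g : Fin (n + 1) → ℝ) :
    ∑ k ∈ range (n + 1), jacobiTerm β v (periodicExtension g) k =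
      g ⬝ᵥ cyclicJacobi β v n *ᵥ g := by
  rw [← Fin.sum_univ_eq_sum_range, dotProduct_cyclicJacobi_mulVec]
  simp only [jacobiTerm, periodicExtension_val, periodicExtension_val_succ]

lemma sum_range_sq_periodicExtension (g : Fin (n + 1) → ℝ) :
    ∑ k ∈ range (n + 1), periodicExtension g k ^ 2 = g ⬝ᵥ g := by
  rw [← Fin.sum_univ_eq_sum_range (fun k => periodicExtension g k ^ 2)]
  simp only [periodicExtension_val, dotProduct, pow_two]

lemma periodic_jacobiTerm (hβ : Function.Periodic β (n + 1)) (hv : Function.Periodic v (n + 1))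
    {h : ℕ → ℝ} (hh : Function.Periodic h (n + 1)) :
    Function.Periodic (jacobiTerm β v h) (n + 1) := fun k => by
  simp only [jacobiTerm, hβ k, hv k, hh k, add_right_comm k (n + 1) 1, hh (k + 1)]

lemma forall_tsum_jacobiTerm_le_iff (hβ : Function.Periodic β (n + 1))
    (hv : Function.Periodic v (n + 1)) (hv0 : ∀ k, 0 ≤ v k) (s : ℝ) :
    (∀ h : ℕ → ℝ, (Summable fun k => h k ^ 2) →
        ∑' k, jacobiTerm β v h k ≤ s * ∑' k, h k ^ 2) ↔
      ∀ g, g ⬝ᵥ cyclicJacobi β v n *ᵥ g ≤ s * (g ⬝ᵥ g) := by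
  refine ⟨fun H g => ?_, fun H h hh => ?_⟩
  · set U := periodicExtension g
    have hU : Function.Periodic U (n + 1) := periodic_periodicExtension g
    -- Truncating after `M + 1` periods costs only a boundary term `E`, independent of `M`.
    set E := 2 * (v n * (U n * U (n + 1)))
    have bound (M : ℕ) : (M + 1 : ℕ) * (g ⬝ᵥ cyclicJacobi β v n *ᵥ g) ≤
        s * ((M + 1 : ℕ) * (g ⬝ᵥ g)) + E := by
      have hN : (n + 1) * (M + 1) = (n + (n + 1) * M) + 1 := by ring
      have hE : E = 2 * (v (n + (n + 1) * M) *
          (U (n + (n + 1) * M) * U (n + (n + 1) * M + 1))) := by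
        rw [add_right_comm, map_add_mul_of_periodic hv, map_add_mul_of_periodic hU,
          map_add_mul_of_periodic hU]
      have key := H _ (hasSum_sq_indicator_Iio U ((n + 1) * (M + 1))).summable
      rw [(hasSum_sq_indicator_Iio U _).tsum_eq, hN,
        (hasSum_jacobiTerm_indicator_Iio β v U _).tsum_eq, ← hE, ← hN,
        sum_range_mul_of_periodic (periodic_jacobiTerm hβ hv hU),
        sum_range_mul_of_periodic (F := fun k => U k ^ 2) (fun k => by simp only [hU k]),
        sum_range_jacobiTerm_periodicExtension, sum_range_sq_periodicExtension] at key
      linarith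
    by_contra! hlt
    obtain ⟨M, hM⟩ := Archimedean.arch E (sub_pos.2 hlt)
    have := bound M
    rw [nsmul_eq_mul] at hM
    push_cast at this
    linarith
  · calc _ ≤ _ := tsum_jacobiTerm_le_foldNorm hβ hv hv0 hh
      _ ≤ _ := H _
      _ = _ := by rw [← tsum_sq_eq_foldNorm_dotProduct hh]

end PeriodicForm

section NumericalRange

/-- The off-diagonal entry at `(k, k + 1)` of the self-adjoint operator `Re (ω T)`. -/
noncomputable def hopping (ω : ℂ) (a c : ℕ → ℂ) (k : ℕ) : ℂ :=
  (ω * c k + conj (ω * a (k + 1))) / 2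

/-- The cyclic Jacobi matrix of one period of `Re (ω T)`, with the off-diagonal entries replaced by
their absolute values. -/
noncomputable abbrev foldedJacobi (ω : ℂ) (a b c : ℕ → ℂ) (n : ℕ) :
    Matrix (Fin (n + 1)) (Fin (n + 1)) ℝ :=
  cyclicJacobi (fun k => (ω * b k).re) (fun k => ‖hopping ω a c k‖) n

/-- Unimodular numbers, conjugation with which turns the off-diagonal sequence `w` into `‖w‖`. -/
noncomputable def gauge (w : ℕ → ℂ) : ℕ → ℂ
  | 0 => 1
  | k + 1 => gauge w k * (if w k = 0 then 1 else conj (w k) / ‖w k‖)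

lemma norm_gauge (w : ℕ → ℂ) (k : ℕ) : ‖gauge w k‖ = 1 := by
  induction k with
  | zero => simp [gauge]
  | succ k ih =>
    rw [gauge, norm_mul, ih]
    split_ifs with h
    · simp
    · simp [h]

lemma conj_gauge_mul_mul_gauge (w : ℕ → ℂ) (k : ℕ) :
    conj (gauge w k) * w k * gauge w (k + 1) = ‖w k‖ := by
  have hunit : conj (gauge w k) * gauge w k = 1 := by
    rw [Complex.conj_mul', norm_gauge]; simp
  rw [gauge]
  split_ifs with h
  · simp [h]
  · have hne : (‖w k‖ : ℂ) ≠ 0 := by simpa using h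
    have hsq := Complex.mul_conj' (w k)
    field_simp
    linear_combination (w k * conj (w k)) * hunit + hsq

lemma hasSum_norm_sq (f : EllTwo) : HasSum (fun k => ‖f k‖ ^ 2) (‖f‖ ^ 2) := by
  simpa using lp.hasSum_norm (p := 2) (by norm_num) f

variable {n : ℕ} {a b c : ℕ → ℂ}

lemma periodic_norm_hopping (ha : Function.Periodic a (n + 1)) (hc : Function.Periodic c (n + 1))
    (ω : ℂ) : Function.Periodic (fun k => ‖hopping ω a c k‖) (n + 1) := fun k => by
  simp only [hopping, hc k, add_right_comm k (n + 1) 1, ha (k + 1)]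

lemma re_mul_add_re_mul_add_re_mul (ω α β γ x y : ℂ) :
    (ω * (β * x * conj x)).re +
        ((ω * (γ * y * conj x)).re + (ω * (α * x * conj y)).re) =
      (ω * β).re * ‖x‖ ^ 2 + 2 * ((ω * γ + conj (ω * α)) / 2 * (conj x * y)).re := by
  have hdiag : ω * (β * x * conj x) = ω * β * (‖x‖ ^ 2 : ℝ) := by
    push_cast [← Complex.mul_conj']
    ring
  have hoff : 2 * ((ω * γ + conj (ω * α)) / 2 * (conj x * y)) =
      ω * (γ * y * conj x) + conj (ω * (α * x * conj y)) := by
    simp only [map_mul, Complex.conj_conj]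
    ring
  rw [hdiag, Complex.re_mul_ofReal, ← Complex.conj_re (ω * (α * x * conj y)), ← Complex.add_re,
    ← hoff]
  simp

variable (ha : Function.Periodic a (n + 1)) (hb : Function.Periodic b (n + 1))
  (hc : Function.Periodic c (n + 1))

lemma hasSum_re_mul_inner_tridiagOp (ω : ℂ) (f : EllTwo) :
    HasSum (fun k => (ω * b k).re * ‖f k‖ ^ 2
        + 2 * (hopping ω a c k * (conj (f k) * f (k + 1))).re)
      (ω * inner ℂ f (tridiagOp ha hb hc f)).re := by
  have htotal := Complex.hasSum_re ((lp.hasSum_inner f (tridiagOp ha hb hc f)).mul_left ω)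
  -- Move the terms `a k * f (k - 1) * conj (f k)` from row `k` to row `k - 1`, by subtracting the
  -- form of the operator with `b = c = 0` and adding it back shifted by one.
  have hz : Function.Periodic (fun _ : ℕ => (0 : ℂ)) (n + 1) := fun _ => rfl
  obtain ⟨S, hsub⟩ := (lp.summable_inner f (tridiagOp ha hz hz f)).mul_left ω
  replace hsub := Complex.hasSum_re hsub
  have hshift := (hasSum_nat_add_iff' 1).2 hsub
  have hzero : ∑ i ∈ range 1, (ω * inner ℂ (f i) (tridiagOp ha hz hz f i)).re = 0 := by
    simp [tridiagOp_apply]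
  rw [hzero, sub_zero] at hshift
  have hsum := (htotal.sub hsub).add hshift
  rw [sub_add_cancel] at hsum
  refine hsum.congr_fun fun k => ?_
  rw [hopping, ← re_mul_add_re_mul_add_re_mul]
  simp only [tridiagOp_apply, RCLike.inner_apply, Nat.succ_ne_zero, if_false, Nat.add_sub_cancel,
    zero_mul, add_zero, add_mul, mul_add, Complex.add_re]
  ring

lemma re_mul_inner_tridiagOp_le (ω : ℂ) (f : EllTwo) :
    (ω * inner ℂ f (tridiagOp ha hb hc f)).re ≤
      ∑' k, jacobiTerm (fun k => (ω * b k).re) (fun k => ‖hopping ω a c k‖) (fun k => ‖f k‖) k := by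
  have hβ : Function.Periodic (fun k => (ω * b k).re) (n + 1) := fun k => by simp only [hb k]
  refine hasSum_le (fun k => ?_) (hasSum_re_mul_inner_tridiagOp ha hb hc ω f)
    (summable_jacobiTerm hβ (periodic_norm_hopping ha hc ω) (hasSum_norm_sq f).summable).hasSum
  have hre := Complex.re_le_norm (hopping ω a c k * (conj (f k) * f (k + 1)))
  rw [norm_mul, norm_mul, RCLike.norm_conj] at hre
  simp only [jacobiTerm]
  gcongr

lemma exists_re_mul_inner_tridiagOp_eq (ω : ℂ) {h : ℕ → ℝ} (hh : Summable fun k => h k ^ 2) :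
    ∃ f : EllTwo, ‖f‖ ^ 2 = ∑' k, h k ^ 2 ∧ (ω * inner ℂ f (tridiagOp ha hb hc f)).re =
      ∑' k, jacobiTerm (fun k => (ω * b k).re) (fun k => ‖hopping ω a c k‖) h k := by
  set e := gauge (hopping ω a c)
  have hnorm (k : ℕ) : ‖h k * e k‖ ^ 2 = h k ^ 2 := by simp [e, norm_gauge]
  let f : EllTwo := ⟨fun k => h k * e k, (memℓp_two_iff _).2 (by simpa only [hnorm] using hh)⟩
  refine ⟨f, ?_, ?_⟩
  · simpa only [f, hnorm] using (hasSum_norm_sq f).tsum_eq.symm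
  · rw [← (hasSum_re_mul_inner_tridiagOp ha hb hc ω f).tsum_eq]
    refine tsum_congr fun k => ?_
    have hgauge : hopping ω a c k * (conj (h k * e k) * (h (k + 1) * e (k + 1))) =
        (‖hopping ω a c k‖ * (h k * h (k + 1)) : ℝ) := by
      push_cast
      rw [← conj_gauge_mul_mul_gauge, map_mul, Complex.conj_ofReal]
      ring
    simp only [f, hnorm, hgauge, Complex.ofReal_re, jacobiTerm]

lemma forall_re_mul_inner_tridiagOp_le_iff (ω : ℂ) (s : ℝ) :
    (∀ f, (ω * inner ℂ f (tridiagOp ha hb hc f)).re ≤ s * ‖f‖ ^ 2) ↔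
      ∀ g, g ⬝ᵥ foldedJacobi ω a b c n *ᵥ g ≤ s * (g ⬝ᵥ g) := by
  rw [← forall_tsum_jacobiTerm_le_iff (fun k => by simp only [hb k])
    (periodic_norm_hopping ha hc ω) (fun _ => norm_nonneg _)]
  refine ⟨fun H h hh => ?_, fun H f => ?_⟩
  · obtain ⟨f, hf, hTf⟩ := exists_re_mul_inner_tridiagOp_eq ha hb hc ω hh
    rw [← hf, ← hTf]
    exact H f
  · rw [← (hasSum_norm_sq f).tsum_eq]
    exact (re_mul_inner_tridiagOp_le ha hb hc ω f).trans (H _ (hasSum_norm_sq f).summable)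

lemma mem_upperBounds_re_mul_numericalRange_iff {E : Type*} [NormedAddCommGroup E]
    [InnerProductSpace ℂ E] (A : E →L[ℂ] E) (ω : ℂ) (s : ℝ) :
    s ∈ upperBounds {r | ∃ z ∈ numericalRange A, (ω * z).re = r} ↔
      ∀ x, (ω * inner ℂ x (A x)).re ≤ s * ‖x‖ ^ 2 := by
  refine ⟨fun H x => ?_, ?_⟩
  · obtain rfl | hx := eq_or_ne x 0
    · simp
    have hx' : ‖x‖ ≠ 0 := norm_ne_zero_iff.2 hx
    have key := H ⟨_, ⟨((‖x‖⁻¹ : ℝ) : ℂ) • x, by simp [norm_smul, hx'], rfl⟩, rfl⟩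
    have hscale : ω * inner ℂ (((‖x‖⁻¹ : ℝ) : ℂ) • x) (A (((‖x‖⁻¹ : ℝ) : ℂ) • x)) =
        (‖x‖⁻¹ ^ 2 : ℝ) * (ω * inner ℂ x (A x)) := by
      simp only [map_smul, inner_smul_left, inner_smul_right, Complex.conj_ofReal]
      push_cast
      ring
    rwa [hscale, Complex.re_ofReal_mul, inv_pow, inv_mul_le_iff₀ (by positivity),
      mul_comm _ s] at key
  · rintro H _ ⟨_, ⟨x, hx, rfl⟩, rfl⟩
    simpa [hx] using H x

lemma isHermitian_foldedJacobi (ω : ℂ) (a b c : ℕ → ℂ) (n : ℕ) :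
    (foldedJacobi ω a b c n).IsHermitian :=
  isHermitian_cyclicJacobi _ _ n

lemma isLUB_re_mul_numericalRange_tridiagOp (ω : ℂ) :
    IsLUB {s | ∃ z ∈ numericalRange (tridiagOp ha hb hc), (ω * z).re = s}
      (⨆ i, (isHermitian_foldedJacobi ω a b c n).eigenvalues i) := by
  rw [isLUB_iff_le_iff]
  intro s
  rw [ciSup_le_iff (Set.finite_range _).bddAbove, ← forall_dotProduct_mulVec_le_iff,
    ← forall_re_mul_inner_tridiagOp_le_iff ha hb hc, mem_upperBounds_re_mul_numericalRange_iff]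

end NumericalRange

section Discriminant

variable {n : ℕ} {a b c : ℕ → ℂ}

/-- The `k`-th diagonal entry of the matrix `Λ`. -/
def symbolDiag (b : ℕ → ℂ) (t x y : ℝ) (k : ℕ) : ℝ :=
  t + (b k).re * x + (b k).im * y

/-- The `k`-th superdiagonal entry `α_k x + γ_k y` of the matrix `Λ`; for `k = n` this is the corner
coefficient. -/
noncomputable def symbolOff (n : ℕ) (a c : ℕ → ℂ) (x y : ℝ) (k : ℕ) : ℂ :=
  alpha n a c k * x + gamma n a c k * y

lemma det_tridiagonal_ofReal_conj (d : ℕ → ℝ) (w : ℕ → ℂ) (m : ℕ) :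
    (tridiagonal (fun k => (d k : ℂ)) w (fun k => conj (w k)) m).det =
      (continuant d (fun k => ‖w k‖ ^ 2) m : ℝ) := by
  simp only [det_tridiagonal, Complex.mul_conj', ← Complex.ofReal_pow]
  exact (map_continuant Complex.ofRealHom _ _ m).symm

lemma entry_eq_tridiagonal (n : ℕ) (a b c : ℕ → ℂ) (t x y : ℝ) {m : ℕ} (i j : Fin m) :
    entry n a b c t x y i j = tridiagonal (fun k => (symbolDiag b t x y k : ℂ))
      (symbolOff n a c x y) (fun k => conj (symbolOff n a c x y k)) m i j := by
  simp only [entry, tridiagonal, symbolDiag, symbolOff, of_apply, map_add, map_mul,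
    Complex.conj_ofReal]

lemma entry_succ_succ_eq_tridiagonal (n : ℕ) (a b c : ℕ → ℂ) (t x y : ℝ) {m : ℕ} (i j : Fin m) :
    entry n a b c t x y (i + 1) (j + 1) = tridiagonal (fun k => (symbolDiag b t x y (k + 1) : ℂ))
      (fun k => symbolOff n a c x y (k + 1))
      (fun k => conj (symbolOff n a c x y (k + 1))) m i j := by
  simp only [entry, tridiagonal, symbolDiag, symbolOff, of_apply, map_add, map_mul,
    Complex.conj_ofReal, Nat.add_right_cancel_iff]

lemma P_eq_monodromyDiscrim (n : ℕ) (a b c : ℕ → ℂ) (t x y : ℝ) :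
    P n a b c t x y =
      (monodromyDiscrim n (symbolDiag b t x y) (fun k => ‖symbolOff n a c x y k‖ ^ 2) : ℝ) := by
  have hG : G n a b c t x y =
      (continuant (symbolDiag b t x y) (fun k => ‖symbolOff n a c x y k‖ ^ 2) (n + 1) : ℝ) := by
    rw [← det_tridiagonal_ofReal_conj, G]
    congr 1 with i j
    exact entry_eq_tridiagonal n a b c t x y i j
  have hH : H n a b c t x y = (continuant (fun k => symbolDiag b t x y (k + 1))
      (fun k => ‖symbolOff n a c x y (k + 1)‖ ^ 2) (n - 1) : ℝ) := by
    rw [← det_tridiagonal_ofReal_conj, H]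
    congr 1 with i j
    exact entry_succ_succ_eq_tridiagonal n a b c t x y i j
  simp only [P, hG, hH, monodromyDiscrim, monodromyTrace]
  push_cast
  rfl

open MvPolynomial in
/-- The diagonal entry `symbolDiag` as a linear form in `(t, x, y)`. -/
noncomputable def symbolDiagPoly (b : ℕ → ℂ) (k : ℕ) : MvPolynomial (Fin 3) ℝ :=
  X 0 + C (b k).re * X 1 + C (b k).im * X 2

open MvPolynomial in
/-- The squared modulus of `symbolOff` as a quadratic form in `(t, x, y)`. -/
noncomputable def normSqSymbolOffPoly (n : ℕ) (a c : ℕ → ℂ) (k : ℕ) : MvPolynomial (Fin 3) ℝ :=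
  (C (alpha n a c k).re * X 1 + C (gamma n a c k).re * X 2) ^ 2
    + (C (alpha n a c k).im * X 1 + C (gamma n a c k).im * X 2) ^ 2

lemma isHomogeneous_symbolDiagPoly (b : ℕ → ℂ) (k : ℕ) :
    (symbolDiagPoly b k).IsHomogeneous 1 :=
  ((MvPolynomial.isHomogeneous_X ℝ 0).add (MvPolynomial.isHomogeneous_C_mul_X _ _)).add
    (MvPolynomial.isHomogeneous_C_mul_X _ _)

lemma isHomogeneous_normSqSymbolOffPoly (n : ℕ) (a c : ℕ → ℂ) (k : ℕ) :
    (normSqSymbolOffPoly n a c k).IsHomogeneous 2 :=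
  have hlin (r s : ℝ) : (MvPolynomial.C r * MvPolynomial.X 1 + MvPolynomial.C s * MvPolynomial.X 2 :
      MvPolynomial (Fin 3) ℝ).IsHomogeneous 1 :=
    (MvPolynomial.isHomogeneous_C_mul_X _ _).add (MvPolynomial.isHomogeneous_C_mul_X _ _)
  ((hlin _ _).pow 2).add ((hlin _ _).pow 2)

lemma eval_symbolDiagPoly (b : ℕ → ℂ) (t x y : ℝ) (k : ℕ) :
    MvPolynomial.eval ![t, x, y] (symbolDiagPoly b k) = symbolDiag b t x y k := by
  simp [symbolDiagPoly, symbolDiag]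

lemma eval_normSqSymbolOffPoly (n : ℕ) (a c : ℕ → ℂ) (t x y : ℝ) (k : ℕ) :
    MvPolynomial.eval ![t, x, y] (normSqSymbolOffPoly n a c k) = ‖symbolOff n a c x y k‖ ^ 2 := by
  rw [Complex.sq_norm, Complex.normSq_apply]
  simp [normSqSymbolOffPoly, symbolOff, pow_two]

lemma exists_isHomogeneous_eval_eq_P (hn : 1 ≤ n) (a b c : ℕ → ℂ) :
    ∃ p : MvPolynomial (Fin 3) ℝ, p.IsHomogeneous (2 * (n + 1)) ∧
      ∀ t x y : ℝ, P n a b c t x y = (MvPolynomial.eval ![t, x, y] p : ℝ) := by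
  refine ⟨monodromyDiscrim n (symbolDiagPoly b) (normSqSymbolOffPoly n a c),
    isHomogeneous_monodromyDiscrim hn (isHomogeneous_symbolDiagPoly b)
      (isHomogeneous_normSqSymbolOffPoly n a c), fun t x y => ?_⟩
  simp only [P_eq_monodromyDiscrim, map_monodromyDiscrim, eval_symbolDiagPoly,
    eval_normSqSymbolOffPoly]

lemma P_zero_zero (n : ℕ) (a b c : ℕ → ℂ) (t : ℝ) :
    P n a b c t 0 0 = (t ^ (2 * (n + 1)) : ℝ) := by
  have hdiag : symbolDiag b t 0 0 = fun _ => t := by ext; simp [symbolDiag]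
  have hoff : (fun k => ‖symbolOff n a c 0 0 k‖ ^ 2) = fun _ => 0 := by ext; simp [symbolOff]
  rw [P_eq_monodromyDiscrim, hdiag, hoff, monodromyDiscrim_const_zero]

lemma half_add_mul_add_half_sub_mul (ω z w : ℂ) :
    (z + w) / 2 * (-ω.re : ℝ) + (z - w) / (2 * Complex.I) * ω.im = -((ω * z + conj ω * w) / 2) := by
  have hω := Complex.re_add_im ω
  have hconj : conj ω = ω.re - ω.im * Complex.I := Complex.ext (by simp) (by simp)
  rw [hconj, div_mul_eq_div_div, Complex.div_I]
  push_cast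
  linear_combination (-z / 2) * hω

lemma symbolOff_of_lt {k : ℕ} (hk : k < n) (ω : ℂ) :
    symbolOff n a c (-ω.re) ω.im k = -hopping ω a c k := by
  rw [symbolOff, alpha, gamma, if_pos hk, if_pos hk, half_add_mul_add_half_sub_mul, hopping,
    map_mul]

lemma symbolOff_self (ha : Function.Periodic a (n + 1)) (ω : ℂ) :
    symbolOff n a c (-ω.re) ω.im n = -conj (hopping ω a c n) := by
  have ha₀ : a (n + 1) = a 0 := by simpa using ha 0
  rw [symbolOff, alpha, gamma, if_neg n.lt_irrefl, if_neg n.lt_irrefl,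
    half_add_mul_add_half_sub_mul, hopping, ha₀]
  simp [add_comm, map_ofNat]

lemma norm_symbolOff_of_le (ha : Function.Periodic a (n + 1)) {k : ℕ} (hk : k ≤ n) (ω : ℂ) :
    ‖symbolOff n a c (-ω.re) ω.im k‖ = ‖hopping ω a c k‖ := by
  obtain rfl | hk := hk.eq_or_lt
  · rw [symbolOff_self ha, norm_neg, RCLike.norm_conj]
  · rw [symbolOff_of_lt hk, norm_neg]

lemma symbolDiag_neg_re_im (b : ℕ → ℂ) (ω : ℂ) (t : ℝ) :
    symbolDiag b t (-ω.re) ω.im = fun k => t - (ω * b k).re := by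
  ext k
  rw [symbolDiag, Complex.mul_re]
  ring

lemma P_eq_eval_charpoly_mul (hn : 1 ≤ n) (ha : Function.Periodic a (n + 1)) (b c : ℕ → ℂ) (ω : ℂ)
    (t : ℝ) : P n a b c t (-ω.re) ω.im =
      ((foldedJacobi ω a b c n).charpoly.eval t * ((foldedJacobi ω a b c n).charpoly.eval t +
        4 * ∏ j ∈ range (n + 1), ‖hopping ω a c j‖) : ℝ) := by
  rw [P_eq_monodromyDiscrim, ← monodromyDiscrim_eq_charpoly_mul hn, symbolDiag_neg_re_im,
    monodromyDiscrim_congr fun k hk => by rw [norm_symbolOff_of_le ha hk]]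

lemma isGreatest_setOf_P_eq_zero (hn : 1 ≤ n) (ha : Function.Periodic a (n + 1)) (b c : ℕ → ℂ)
    (ω : ℂ) : IsGreatest {t : ℝ | P n a b c t (-ω.re) ω.im = 0}
      (⨆ i, (isHermitian_foldedJacobi ω a b c n).eigenvalues i) := by
  simp only [P_eq_eval_charpoly_mul hn ha, Complex.ofReal_eq_zero]
  exact isGreatest_setOf_eval_charpoly_mul _ (by positivity)

end Discriminant

end PeriodicTridiagonal

theorem proposition2p4 (n : ℕ) (hn : 1 ≤ n) (a b c : ℕ → ℂ)
    (ha : Function.Periodic a (n + 1)) (hb : Function.Periodic b (n + 1))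
    (hc : Function.Periodic c (n + 1)) :
    (∃ p : MvPolynomial (Fin 3) ℝ, p.IsHomogeneous (2 * (n + 1)) ∧
      ∀ t x y : ℝ, PeriodicTridiagonal.P n a b c t x y = ((MvPolynomial.eval ![t, x, y] p : ℝ) : ℂ)) ∧
    (∀ t : ℝ, PeriodicTridiagonal.P n a b c t 0 0 = ((t ^ (2 * (n + 1)) : ℝ) : ℂ)) ∧
    ∀ θ : ℝ, ∃ m : ℝ,
      IsLUB {s : ℝ | ∃ z ∈ PeriodicTridiagonal.numericalRange
          (PeriodicTridiagonal.tridiagOp ha hb hc),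
          (Complex.exp (-(Complex.I * θ)) * z).re = s} m ∧
      IsGreatest {t : ℝ |
          PeriodicTridiagonal.P n a b c t (-Real.cos θ) (-Real.sin θ) = 0} m := by
  refine ⟨PeriodicTridiagonal.exists_isHomogeneous_eval_eq_P hn a b c,
    PeriodicTridiagonal.P_zero_zero n a b c, fun θ => ?_⟩
  set ω := Complex.exp (-(Complex.I * θ)) with hω
  have hre : Real.cos θ = ω.re := by simp [hω, Complex.exp_re]
  have him : -Real.sin θ = ω.im := by simp [hω, Complex.exp_im]
  rw [hre, him]
  exact ⟨_, PeriodicTridiagonal.isLUB_re_mul_numericalRange_tridiagOp ha hb hc ω,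
    PeriodicTridiagonal.isGreatest_setOf_P_eq_zero hn ha b c ω⟩
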